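/- **Setting.** A boundary vertex is a point of $\{(i,0):i\ge 1\}\cup\{(0,j):j\ge 1\}$. Boundary data $b$ specify which boundary vertices emit an arrow into the bulk $\mathbb{Z}_{>0}^2$: horizontally, from $(0,j)$ to $(1,j)$, or vertically, from $(i,0)$ to $(i,1)$. Write $b\ge b'$ if $b$ has every arrow of $b'$. Let $\delta_1,\delta_2\in[0,1]$. The stochastic six vertex (S6V) model with boundary data $b$ is the random set of arrows obtained by sampling the vertices of $\mathbb{Z}_{>0}^2$ successively along the anti-diagonals $x+y=2,3,\dots$, independently given their incoming arrows: a vertex with no incoming arrow has no outgoing arrow; a vertex with two incoming arrows has both outgoing arrows; if only a vertical arrow comes in, it goes straight up with probability $\delta_1$ and turns right with probability $1-\delta_1$; if only a horizontal arrow comes in, it goes straight to the right with probability $\delta_2$ and turns up with probability $1-\delta_2$. Random boundary data are sampled first, independently of the randomness at the vertices. Let $v_0$ be a boundary vertex from which $b$ has no arrow, and let $b^+$ be $b$ with an arrow from $v_0$ added. Run the two models $\xi$ and $\xi^+$ with boundary data $b$ and $b^+$ with the same randomness: independent Bernoulli variables $v_{xy}$ (parameter $\delta_1$) and $h_{xy}$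 (parameter $\delta_2$), attached to the vertices, decide whether a single vertical, respectively horizontal, incoming arrow goes straight. Then $\xi^+\supseteq\xi$, and the edges of $\xi^+$ that are not in $\xi$ form an up-right path $Q_\xi$ starting at $v_0$. This path is the second class particle, and the law of $(\xi,Q_\xi)$ is the S6V model with boundary data $b$ and second class particle starting at $v_0$. **Proposition 3.4.** Let $1>\delta_1>\delta_2\ge 0$ and $\delta_2\le\frac12$. Let $v_0=(i_0,j_0)$ be a boundary vertex and let $\xi_0^-,\eta_0$ be (deterministic, or jointly distributed random) boundary data such that, almost surely, neither contains an arrow emanating from $v_0$, and $\xi_0^-\ge\eta_0$. Then there is a coupling, that is, a probability measure under which 1. $(\xi^-,Q_{\xi^-})$ is distributed as the S6V model with boundary data $\xi_0^-$ and second class particle starting at $v_0$; 2. $(\eta,Q_\eta)$ is distributed as the S6V model with boundary data $\eta_0$ and second class particle starting at $v_0$; 3. the boundary data of $\xi^-$ and $\eta$ have jointly the given law of $(\xi_0^-,\eta_0)$; and such that, almost surely, for every $n\ge i_0+j_0$, each of $Q_{\xi^-}$ and $Q_\eta$ meets the line $\{x+y=n\}$ in exactly one vertex, and the vertex of $Q_{\xi^-}$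 lies weakly to the southeast of the vertex of $Q_\eta$. -/

import Mathlib

open MeasureTheory ProbabilityTheory

/-- The boundary vertices of the quadrant: the points of `ℕ × ℕ` on one of the two coordinate
axes, except the origin. -/
abbrev BoundaryVertex : Type := {v : ℕ × ℕ // (v.1 = 0 ∨ v.2 = 0) ∧ v ≠ (0, 0)}

/-- Boundary data: which boundary vertices emit an arrow into the bulk (`(0, j)` emits it
horizontally, into `(1, j)`; `(i, 0)` emits it vertically, into `(i, 1)`).
The order is the pointwise one, so `η₀ ≤ ξ₀` says that `ξ₀` has every arrow of `η₀`. -/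
abbrev BoundaryData : Type := BoundaryVertex → Bool

/-- A set of arrows in the quadrant, recorded by the outgoing edges of each vertex:
`(E (x, y)).1` tells whether the edge `(x, y) → (x + 1, y)` is present,
`(E (x, y)).2` whether the edge `(x, y) → (x, y + 1)` is present. -/
abbrev ArrowEnsemble : Type := ℕ × ℕ → Bool × Bool

/-- The bits that drive the model: at the vertex `(x, y)` the first bit says whether a single arrow
entering vertically passes straight through, the second bit whether a single arrow entering
horizontally passes straight through. -/
abbrev VertexBits : Type := ℕ × ℕ → Bool × Bool

/-- The outgoing arrows (horizontal, vertical) of a vertex with bits `c`, given whether there are an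
incoming horizontal arrow `inH` and an incoming vertical arrow `inV`. -/
def vertexOut (c : Bool × Bool) (inH inV : Bool) : Bool × Bool :=
  match inH, inV with
  | false, false => (false, false)
  | false, true => (!c.1, c.1)
  | true, false => (c.2, !c.2)
  | true, true => (true, true)

/-- Outgoing arrows at `(x, y)` of the path ensemble with boundary data `b` and bits `ω`. -/
def outgoing (b : BoundaryData) (ω : VertexBits) : ℕ → ℕ → Bool × Bool
  | 0, 0 => (false, false)
  | 0, y + 1 => (b ⟨(0, y + 1), by simp⟩, false)
  | x + 1, 0 => (false, b ⟨(x + 1, 0), by simp⟩)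
  | x + 1, y + 1 =>
      vertexOut (ω (x + 1, y + 1)) (outgoing b ω x (y + 1)).1 (outgoing b ω (x + 1) y).2
  termination_by x y => x + y

/-- The six vertex path ensemble with boundary data `b` and bits `ω`. -/
def sixVertexEnsemble (b : BoundaryData) (ω : VertexBits) : ArrowEnsemble :=
  fun v => outgoing b ω v.1 v.2

/-- The boundary data of a path ensemble. -/
def ArrowEnsemble.boundary (E : ArrowEnsemble) : BoundaryData :=
  fun v => if v.1.1 = 0 then (E v.1).1 else (E v.1).2

/-- The boundary data `b` with an arrow emanating from `v₀` added. -/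
def addArrow (b : BoundaryData) (v₀ : BoundaryVertex) : BoundaryData :=
  Function.update b v₀ true

/-- The grey arrows: those present in `E'` but not in `E`. -/
def discrepancy (E' E : ArrowEnsemble) : ArrowEnsemble :=
  fun v => ((E' v).1 && !(E v).1, (E' v).2 && !(E v).2)

/-- The path ensemble `ξ` with boundary data `b`, together with the second class particle `Q`
starting at `v₀`: the same bits (basic coupling) generate `ξ` from `b` and `ξ⁺` from `b` with an
arrow from `v₀` added, and `Q` consists of the edges of `ξ⁺` that are not in `ξ`. -/
def ensembleWithSecondClass (v₀ : BoundaryVertex) (b : BoundaryData) (ω : VertexBits) :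
    ArrowEnsemble × ArrowEnsemble :=
  (sixVertexEnsemble b ω,
    discrepancy (sixVertexEnsemble (addArrow b v₀) ω) (sixVertexEnsemble b ω))

/-- The law of the bits: all independent, Bernoulli of parameter `δ₁` for vertical arrows and of
parameter `δ₂` for horizontal arrows. -/
noncomputable def vertexBitsLaw (δ₁ δ₂ : unitInterval) : Measure VertexBits :=
  Measure.infinitePi fun _ : ℕ × ℕ =>
    (bernoulliMeasure true false δ₁).prod (bernoulliMeasure true false δ₂)

/-- The law of the stochastic six vertex model together with its second class particle starting at
`v₀`, for random boundary data of law `ν` (a point mass if they are deterministic): the bits are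
independent of the boundary data. The first component is the path ensemble, the second one is
the set of edges of the second class particle. -/
noncomputable def secondClassLaw (δ₁ δ₂ : unitInterval) (v₀ : BoundaryVertex)
    (ν : Measure BoundaryData) : Measure (ArrowEnsemble × ArrowEnsemble) :=
  (ν.prod (vertexBitsLaw δ₁ δ₂)).map fun z => ensembleWithSecondClass v₀ z.1 z.2

/-- The edge set `Q` has an edge leaving the vertex `v`. -/
def PassesThrough (Q : ArrowEnsemble) (v : ℕ × ℕ) : Prop :=
  (Q v).1 = true ∨ (Q v).2 = true

/-- `Q` and `Q'` each meet the line `x + y = n` in exactly one vertex, and the vertex of `Q` lies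
weakly to the southeast of the vertex of `Q'`. -/
def WeaklySoutheastOnLine (Q Q' : ArrowEnsemble) (n : ℕ) : Prop :=
  ∃ u u' : ℕ × ℕ,
    (∀ v : ℕ × ℕ, v.1 + v.2 = n ∧ PassesThrough Q v ↔ v = u) ∧
    (∀ v : ℕ × ℕ, v.1 + v.2 = n ∧ PassesThrough Q' v ↔ v = u') ∧
    u'.1 ≤ u.1 ∧ u.2 ≤ u'.2

/-- The map under which `secondClassLaw` is an image measure is measurable. -/
theorem measurable_ensembleWithSecondClass (v₀ : BoundaryVertex) :
    Measurable fun z : BoundaryData × VertexBits => ensembleWithSecondClass v₀ z.1 z.2 := by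
  have key : ∀ n x y : ℕ, x + y = n →
      Measurable fun z : BoundaryData × VertexBits => outgoing z.1 z.2 x y := by
    intro n
    induction n with
    | zero =>
      intro x y h
      obtain ⟨rfl, rfl⟩ : x = 0 ∧ y = 0 := by omega
      simp only [outgoing]
      fun_prop
    | succ n ih =>
      intro x y h
      match x, y, h with
      | 0, y + 1, _ => simp only [outgoing]; fun_prop
      | x + 1, 0, _ => simp only [outgoing]; fun_prop
      | x + 1, y + 1, h =>
        have h₁ := ih x (y + 1) (by omega)
        have h₂ := ih (x + 1) y (by omega)
        have h₃ : Measurable fun p : (Bool × Bool) × Bool × Bool =>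
          vertexOut p.1 p.2.1 p.2.2 := measurable_of_countable _
        have h₄ : Measurable fun z : BoundaryData × VertexBits =>
            (z.2 (x + 1, y + 1), (outgoing z.1 z.2 x (y + 1)).1,
              (outgoing z.1 z.2 (x + 1) y).2) := by fun_prop
        simp only [outgoing]
        exact h₃.comp h₄
  have hE : Measurable fun z : BoundaryData × VertexBits => sixVertexEnsemble z.1 z.2 :=
    measurable_pi_lambda _ fun v => key _ v.1 v.2 rfl
  have hadd : Measurable fun z : BoundaryData × VertexBits => (addArrow z.1 v₀, z.2) := by
    refine Measurable.prodMk (measurable_pi_lambda _ fun v => ?_) measurable_snd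
    by_cases hv : v = v₀
    · subst hv; simp [addArrow]
    · simp only [addArrow, Function.update_of_ne hv]; fun_prop
  have hE' : Measurable fun z : BoundaryData × VertexBits =>
      sixVertexEnsemble (addArrow z.1 v₀) z.2 := hE.comp hadd
  refine hE.prodMk (measurable_pi_lambda _ fun v => ?_)
  have hd : Measurable fun p : (Bool × Bool) × Bool × Bool =>
    (p.1.1 && !p.2.1, p.1.2 && !p.2.2) := measurable_of_countable _
  exact hd.comp (((measurable_pi_apply v).comp hE').prodMk ((measurable_pi_apply v).comp hE))

/-! Both systems are driven by one random field, so that η ≤ ξ⁻ ≤ ξ⁺ and η ≤ η⁺ ≤ ξ⁺ persist. At an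
ordinary vertex they use the same bits, and monotonicity of the vertex rule preserves the
inclusions. The exception is a vertex where ξ⁺ has both incoming arrows and η has none: there ξ⁺
emits both and η none whatever the bits, so the bits of the two systems may be coupled freely
(`EdgeState.Admissible.out`).

The particles Q_ξ and Q_η can only exchange order at a vertex they share. At a shared ordinary
vertex they arrive and leave together. At a shared exceptional vertex ξ⁻ and η⁺ have one incoming
arrow each; Q_η follows the arrow of η⁺, and Q_ξ takes the edge left free by the arrow of ξ⁻. If
both particles arrive vertically, they go up with probability δ₂ (Q_ξ) and δ₁ (Q_η); if both arrive
horizontally, they go right with probability δ₁ and δ₂. Since δ₂ < δ₁, both pairs of events can be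
nested in the desired direction. If Q_ξ arrives vertically and Q_η horizontally, the order breaks
only when the arrows of ξ⁻ and η⁺ both go straight right; these events of probability δ₂ can be made
disjoint because δ₂ ≤ 1/2. `CompatibleBits` records these three requirements, and
`weaklySoutheastOnLine_of_compatibleBits` deduces the ordering of the paths.

The marginals survive because, given the past, the bits of each system at a vertex have the
prescribed law (`map_coupledBits`); hence each field of bits is i.i.d.
(`map_infinitePi_of_adapted`). -/

/-! ### Adapted transformations of i.i.d. fields -/

/-- Resampling one coordinate of an i.i.d. field does not change its law. -/
theorem measurePreserving_update_infinitePi {V Θ : Type*} [DecidableEq V] [MeasurableSpace Θ]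
    (μ : Measure Θ) [IsProbabilityMeasure μ] (v : V) :
    MeasurePreserving (fun p : Θ × (V → Θ) => Function.update p.2 v p.1)
      (μ.prod (Measure.infinitePi fun _ => μ)) (Measure.infinitePi fun _ => μ) := by
  have hm : Measurable fun p : Θ × (V → Θ) => Function.update p.2 v p.1 := by
    refine measurable_pi_lambda _ fun w => ?_
    by_cases hw : w = v
    · subst hw; simpa using measurable_fst
    · simp only [Function.update_of_ne hw]; fun_prop
  refine ⟨hm, Measure.eq_infinitePi _ fun s t ht => ?_⟩
  rw [Measure.map_apply hm (.pi s.countable_toSet fun i _ => ht i)]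
  have hpre : (fun p : Θ × (V → Θ) => Function.update p.2 v p.1) ⁻¹' (Set.pi s t) =
      (if v ∈ s then t v else Set.univ) ×ˢ Set.pi (s.erase v) t := by
    ext p
    simp only [Set.mem_preimage, Set.mem_pi, Finset.mem_coe, Set.mem_prod, Finset.mem_erase]
    constructor
    · intro h
      refine ⟨?_, fun i hi => by simpa [Function.update_of_ne hi.1] using h i hi.2⟩
      split_ifs with hv
      · simpa using h v hv
      · trivial
    · rintro ⟨h, h'⟩ i hi
      by_cases hiv : i = v
      · subst hiv; simpa [hi] using h
      · simpa [Function.update_of_ne hiv] using h' i ⟨hiv, hi⟩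
  rw [hpre, Measure.prod_prod, Measure.infinitePi_pi _ fun i _ => ht i]
  split_ifs with hv
  · exact Finset.mul_prod_erase s (fun i => μ (t i)) hv
  · rw [measure_univ, one_mul, Finset.erase_eq_of_notMem hv]

/-- A field that is adapted to an i.i.d. field (with respect to a rank function on the sites) and
whose value at every site has law `ν` given the past is itself i.i.d. of law `ν`. -/
theorem map_infinitePi_of_adapted {V Θ S : Type*} [DecidableEq V] [MeasurableSpace Θ]
    [MeasurableSpace S] (μ : Measure Θ) [IsProbabilityMeasure μ] (ν : Measure S)
    [IsProbabilityMeasure ν] (rank : V → ℕ) (G : (V → Θ) → V → S) (hG : Measurable G)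
    (hadapted : ∀ v w u θ, w ≠ v → rank v ≤ rank w → G (Function.update u w θ) v = G u v)
    (hlaw : ∀ v u, μ.map (fun θ => G (Function.update u v θ) v) = ν) :
    (Measure.infinitePi fun _ => μ).map G = Measure.infinitePi fun _ => ν := by
  refine Measure.eq_infinitePi _ fun s t ht => ?_
  rw [Measure.map_apply hG (.pi s.countable_toSet fun i _ => ht i)]
  induction hn : s.card generalizing s with
  | zero => simp [Finset.card_eq_zero.mp hn]
  | succ n ih =>
    -- By maximality of the rank, resampling the coordinate `v` leaves the field unchanged at all
    -- other sites of `s`; integrating it out first yields the factor `ν (t v)`.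
    obtain ⟨v, hv, hmax⟩ := s.exists_max_image rank (Finset.card_pos.mp (by omega))
    have hup := measurePreserving_update_infinitePi (V := V) μ v
    set A : Set (V → Θ) := G ⁻¹' Set.pi (s.erase v) t with hA
    have hAm : MeasurableSet A := hG (.pi (s.erase v).countable_toSet fun i _ => ht i)
    have hGv : Measurable fun u => G u v := (measurable_pi_apply v).comp hG
    have hsplit : G ⁻¹' Set.pi s t = A ∩ {u | G u v ∈ t v} := by
      ext u
      simp only [hA, Set.mem_preimage, Set.mem_pi, Finset.mem_coe, Set.mem_inter_iff,
        Finset.mem_erase, Set.mem_ofPred_eq]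
      refine ⟨fun h => ⟨fun i hi => h i hi.2, h v hv⟩, fun h i hi => ?_⟩
      by_cases hiv : i = v
      · exact hiv ▸ h.2
      · exact h.1 i ⟨hiv, hi⟩
    have hAinv : ∀ u θ, Function.update u v θ ∈ A ↔ u ∈ A := by
      intro u θ
      simp only [hA, Set.mem_preimage, Set.mem_pi, Finset.mem_coe, Finset.mem_erase]
      refine forall₂_congr fun i hi => ?_
      rw [hadapted i v u θ hi.1.symm (hmax i hi.2)]
    have hBm : MeasurableSet {u | G u v ∈ t v} := hGv (ht v)
    rw [hsplit, ← hup.measure_preimage (hAm.inter hBm).nullMeasurableSet,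
      Measure.prod_apply_symm (hup.measurable (hAm.inter hBm))]
    have hslice : ∀ u, μ ((fun θ => (θ, u)) ⁻¹'
        ((fun p : Θ × (V → Θ) => Function.update p.2 v p.1) ⁻¹' (A ∩ {u | G u v ∈ t v}))) =
        A.indicator (fun _ => ν (t v)) u := by
      intro u
      have hmu : Measurable fun θ => G (Function.update u v θ) v :=
        hGv.comp (hup.measurable.comp (measurable_id.prodMk measurable_const))
      by_cases hu : u ∈ A
      · rw [Set.indicator_of_mem hu, ← hlaw v u, Measure.map_apply hmu (ht v)]
        congr 1
        ext θ
        simp [hAinv, hu]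
      · rw [Set.indicator_of_notMem hu]
        convert measure_empty (μ := μ)
        ext θ
        simp [hAinv, hu]
    simp_rw [hslice]
    rw [lintegral_indicator_const hAm, hA, ih (s.erase v) (by rw [Finset.card_erase_of_mem hv, hn]; rfl)]
    exact Finset.mul_prod_erase s (fun i => ν (t i)) hv

/-! ### Bernoulli bits from uniform variables -/

theorem Bool.measure_ext_of_true {μ ν : Measure Bool} [IsProbabilityMeasure μ]
    [IsProbabilityMeasure ν] (h : μ {true} = ν {true}) : μ = ν := by
  have hf : ({false} : Set Bool) = {true}ᶜ := by ext b; cases b <;> simp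
  refine Measure.ext_of_singleton fun b => ?_
  cases b
  · rw [hf, prob_compl_eq_one_sub (by measurability), prob_compl_eq_one_sub (by measurability), h]
  · exact h

theorem measurable_decide_lt (p : unitInterval) :
    Measurable fun u : unitInterval => decide (u < p) :=
  measurable_to_bool (by
    rw [show (fun u : unitInterval => decide (u < p)) ⁻¹' {true} = Set.Iio p by ext; simp]
    exact measurableSet_Iio)

/-- A uniform variable is below `p` with probability `p`. -/
theorem map_decide_lt_volume (p : unitInterval) :
    (volume : Measure unitInterval).map (fun u => decide (u < p)) =
      bernoulliMeasure true false p := by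
  have hm := measurable_decide_lt p
  have := Measure.isProbabilityMeasure_map (μ := (volume : Measure unitInterval)) hm.aemeasurable
  refine Bool.measure_ext_of_true ?_
  have hB : bernoulliMeasure true false p {true} = unitInterval.toNNReal p :=
    bernoulliMeasure_apply_of_mem_of_notMem p (by measurability) rfl (by simp)
  rw [Measure.map_apply hm (by measurability),
    show (fun u : unitInterval => decide (u < p)) ⁻¹' {true} = Set.Iio p by ext; simp,
    unitInterval.volume_Iio, hB, ENNReal.ofReal, Real.toNNReal_of_nonneg p.2.1]
  rfl

/-! ### Local rules for the four ensembles at one vertex -/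

/-- The occupation of an edge in the four ensembles `ξ⁻, ξ⁺, η, η⁺`. -/
abbrev EdgeState : Type := Bool × Bool × Bool × Bool

/-- The edge states that respect `η ≤ ξ⁻ ≤ ξ⁺` and `η ≤ η⁺ ≤ ξ⁺`. -/
def EdgeState.Admissible (e : EdgeState) : Prop :=
  e.2.2.1 ≤ e.1 ∧ e.1 ≤ e.2.1 ∧ e.2.2.1 ≤ e.2.2.2 ∧ e.2.2.2 ≤ e.2.1

/-- `ξ⁺` occupies both incoming edges and `η` none. -/
def bothSecondClass (H V : EdgeState) : Bool :=
  H.2.1 && V.2.1 && !H.2.2.1 && !V.2.2.1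

/-- Outgoing edge states of a vertex at which `ξ⁻, ξ⁺` use the bits `c` and `η, η⁺` the bits `c'`. -/
def edgeStateOut (c c' : Bool × Bool) (H V : EdgeState) : EdgeState × EdgeState :=
  let o₁ := vertexOut c H.1 V.1
  let o₂ := vertexOut c H.2.1 V.2.1
  let o₃ := vertexOut c' H.2.2.1 V.2.2.1
  let o₄ := vertexOut c' H.2.2.2 V.2.2.2
  ((o₁.1, o₂.1, o₃.1, o₄.1), (o₁.2, o₂.2, o₃.2, o₄.2))

/-- The bits `c` of `ξ` and `c'` of `η` agree except when two second class particles meet, and then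
they keep the marked particle of `ξ` weakly to the right of the marked particle of `η`. -/
def CompatibleBits (H V : EdgeState) (c c' : Bool × Bool) : Prop :=
  if bothSecondClass H V then
    (V.1 = false → V.2.2.2 = true → c.2 ≤ c'.1) ∧
    (V.1 = true → V.2.2.2 = false → c'.2 ≤ c.1) ∧
    (V.1 = false → V.2.2.2 = false → (c.2 && c'.2) = false)
  else c = c'

instance (e : EdgeState) : Decidable e.Admissible := by
  unfold EdgeState.Admissible; infer_instance

instance (H V : EdgeState) (c c' : Bool × Bool) : Decidable (CompatibleBits H V c c') := by
  unfold CompatibleBits; infer_instance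

/-- When two second class particles meet, ξ⁺ fills both outgoing edges and η neither, so every
inequality is trivial. Otherwise the bits agree and `vertexOut` is monotone in the incoming arrows.
-/
theorem EdgeState.Admissible.out {H V : EdgeState} {c c' : Bool × Bool} (hH : H.Admissible)
    (hV : V.Admissible) (hc : CompatibleBits H V c c') :
    (edgeStateOut c c' H V).1.Admissible ∧ (edgeStateOut c c' H V).2.Admissible := by
  revert H V c c'
  decide +kernel

set_option synthInstance.maxHeartbeats 200000 in
set_option synthInstance.maxSize 1000 in
/-- If both marked particles arrive at a vertex, that of `ξ` not to the left of that of `η`, then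
they leave it in the same order. -/
theorem CompatibleBits.marked_right {H V : EdgeState} {c c' : Bool × Bool} (hH : H.Admissible)
    (hV : V.Admissible) (hc : CompatibleBits H V c c')
    (hξ : (V.2.1 && !V.1) = !(H.2.1 && !H.1)) (hη : (V.2.2.2 && !V.2.2.1) = !(H.2.2.2 && !H.2.2.1))
    (hle : (H.2.1 && !H.1) ≤ (H.2.2.2 && !H.2.2.1))
    (hout : ((edgeStateOut c c' H V).1.2.2.2 && !(edgeStateOut c c' H V).1.2.2.1) = true) :
    ((edgeStateOut c c' H V).1.2.1 && !(edgeStateOut c c' H V).1.1) = true := by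
  -- Behind the finite check: with equal bits the marked particles share their incoming edge and
  -- move together. When `bothSecondClass` holds, the marked particle of ξ leaves by the edge that
  -- ξ⁻ does not use, that of η by the edge that η⁺ uses. `hle` excludes ξ arriving horizontally and
  -- η vertically.
  revert H V c c'
  decide +kernel

/-! ### Ordering of the four ensembles on the quadrant -/

theorem outgoing_succ_succ (b : BoundaryData) (ω : VertexBits) (x y : ℕ) :
    outgoing b ω (x + 1) (y + 1) =
      vertexOut (ω (x + 1, y + 1)) (outgoing b ω x (y + 1)).1 (outgoing b ω (x + 1) y).2 := by
  rw [outgoing]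

/-- The edges leaving `(x, y)` in the four ensembles. -/
def edgeStates (v₀ : BoundaryVertex) (b b' : BoundaryData) (ω ω' : VertexBits) (x y : ℕ) :
    EdgeState × EdgeState :=
  let o₁ := outgoing b ω x y
  let o₂ := outgoing (addArrow b v₀) ω x y
  let o₃ := outgoing b' ω' x y
  let o₄ := outgoing (addArrow b' v₀) ω' x y
  ((o₁.1, o₂.1, o₃.1, o₄.1), (o₁.2, o₂.2, o₃.2, o₄.2))

theorem edgeStates_succ_succ (v₀ : BoundaryVertex) (b b' : BoundaryData) (ω ω' : VertexBits)
    (x y : ℕ) :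
    edgeStates v₀ b b' ω ω' (x + 1) (y + 1) =
      edgeStateOut (ω (x + 1, y + 1)) (ω' (x + 1, y + 1))
        (edgeStates v₀ b b' ω ω' x (y + 1)).1 (edgeStates v₀ b b' ω ω' (x + 1) y).2 := by
  simp only [edgeStates, edgeStateOut, outgoing_succ_succ]

theorem addArrow_of_ne {b : BoundaryData} {v₀ v : BoundaryVertex} (h : v ≠ v₀) :
    addArrow b v₀ v = b v := Function.update_of_ne h _ _

theorem addArrow_self (b : BoundaryData) (v₀ : BoundaryVertex) : addArrow b v₀ v₀ = true :=
  Function.update_self _ _ _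

theorem admissible_boundary {v₀ v : BoundaryVertex} {b b' : BoundaryData}
    (hb : b v₀ = false) (hb' : b' v₀ = false) (hle : b' ≤ b) :
    EdgeState.Admissible (b v, addArrow b v₀ v, b' v, addArrow b' v₀ v) := by
  by_cases hv : v = v₀
  · subst hv
    rw [hb, hb', addArrow_self, addArrow_self]
    decide
  · rw [addArrow_of_ne hv, addArrow_of_ne hv]
    exact ⟨hle v, le_rfl, le_rfl, hle v⟩

theorem edgeStates_admissible {v₀ : BoundaryVertex} {b b' : BoundaryData} {ω ω' : VertexBits}
    (hb : b v₀ = false) (hb' : b' v₀ = false) (hle : b' ≤ b)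
    (hc : ∀ x y, CompatibleBits (edgeStates v₀ b b' ω ω' x (y + 1)).1
      (edgeStates v₀ b b' ω ω' (x + 1) y).2 (ω (x + 1, y + 1)) (ω' (x + 1, y + 1)))
    (x y : ℕ) :
    (edgeStates v₀ b b' ω ω' x y).1.Admissible ∧ (edgeStates v₀ b b' ω ω' x y).2.Admissible := by
  induction hn : x + y generalizing x y with
  | zero =>
    obtain ⟨rfl, rfl⟩ : x = 0 ∧ y = 0 := by omega
    simp only [edgeStates, outgoing]
    decide
  | succ n ih =>
    match x, y, hn with
    | 0, y + 1, _ =>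
      simp only [edgeStates, outgoing]
      exact ⟨admissible_boundary hb hb' hle, by decide⟩
    | x + 1, 0, _ =>
      simp only [edgeStates, outgoing]
      exact ⟨by decide, admissible_boundary hb hb' hle⟩
    | x + 1, y + 1, hn =>
      rw [edgeStates_succ_succ]
      exact (ih x (y + 1) (by omega)).1.out (ih (x + 1) y (by omega)).2 (hc x y)

/-! ### The second class particle is a single up-right path -/

/-- The second class particle of the basic coupling. -/
def secondClassPath (v₀ : BoundaryVertex) (b : BoundaryData) (ω : VertexBits) : ArrowEnsemble :=
  (ensembleWithSecondClass v₀ b ω).2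

theorem secondClassPath_apply (v₀ : BoundaryVertex) (b : BoundaryData) (ω : VertexBits)
    (v : ℕ × ℕ) :
    secondClassPath v₀ b ω v =
      ((outgoing (addArrow b v₀) ω v.1 v.2).1 && !(outgoing b ω v.1 v.2).1,
        (outgoing (addArrow b v₀) ω v.1 v.2).2 && !(outgoing b ω v.1 v.2).2) := rfl

theorem secondClassPath_fst_edge (v₀ : BoundaryVertex) (b b' : BoundaryData) (ω ω' : VertexBits)
    (v : ℕ × ℕ) :
    secondClassPath v₀ b ω v =
      ((edgeStates v₀ b b' ω ω' v.1 v.2).1.2.1 && !(edgeStates v₀ b b' ω ω' v.1 v.2).1.1,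
        (edgeStates v₀ b b' ω ω' v.1 v.2).2.2.1 && !(edgeStates v₀ b b' ω ω' v.1 v.2).2.1) := rfl

theorem secondClassPath_snd_edge (v₀ : BoundaryVertex) (b b' : BoundaryData) (ω ω' : VertexBits)
    (v : ℕ × ℕ) :
    secondClassPath v₀ b' ω' v =
      ((edgeStates v₀ b b' ω ω' v.1 v.2).1.2.2.2 && !(edgeStates v₀ b b' ω ω' v.1 v.2).1.2.2.1,
        (edgeStates v₀ b b' ω ω' v.1 v.2).2.2.2.2 &&
          !(edgeStates v₀ b b' ω ω' v.1 v.2).2.2.2.1) := rfl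

/-- Attractivity: for fixed bits, an additional incoming arrow at a vertex never removes an outgoing
one. -/
theorem outgoing_mono {b b' : BoundaryData} (h : b ≤ b') (ω : VertexBits) (x y : ℕ) :
    outgoing b ω x y ≤ outgoing b' ω x y := by
  have key : ∀ (c : Bool × Bool) (H V H' V' : Bool), H ≤ H' → V ≤ V' →
      vertexOut c H V ≤ vertexOut c H' V' := by decide
  induction hn : x + y generalizing x y with
  | zero =>
    obtain ⟨rfl, rfl⟩ : x = 0 ∧ y = 0 := by omega
    simp only [outgoing]; exact le_rfl
  | succ n ih =>
    match x, y, hn with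
    | 0, y + 1, _ => simp only [outgoing]; exact ⟨h _, le_rfl⟩
    | x + 1, 0, _ => simp only [outgoing]; exact ⟨le_rfl, h _⟩
    | x + 1, y + 1, hn =>
      rw [outgoing_succ_succ, outgoing_succ_succ]
      exact key _ _ _ _ _ (ih x (y + 1) (by omega)).1 (ih (x + 1) y (by omega)).2

theorem le_addArrow (b : BoundaryData) (v₀ : BoundaryVertex) : b ≤ addArrow b v₀ := by
  intro v
  by_cases hv : v = v₀
  · subst hv; rw [addArrow_self]; exact Bool.le_true _
  · rw [addArrow_of_ne hv]

/-- Single vertex form of the conservation of second class particles. -/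
theorem vertexOut_discrepancy (c : Bool × Bool) {H V H' V' : Bool} (hH : H ≤ H') (hV : V ≤ V') :
    ((H' && !H) = false → (V' && !V) = false →
      ((vertexOut c H' V').1 && !(vertexOut c H V).1) = false ∧
      ((vertexOut c H' V').2 && !(vertexOut c H V).2) = false) ∧
    ((V' && !V) = (!(H' && !H)) →
      ((vertexOut c H' V').2 && !(vertexOut c H V).2) =
        !((vertexOut c H' V').1 && !(vertexOut c H V).1)) := by
  revert c H V H' V'
  decide

theorem secondClassPath_succ_succ (v₀ : BoundaryVertex) (b : BoundaryData) (ω : VertexBits)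
    (x y : ℕ) :
    ((secondClassPath v₀ b ω (x, y + 1)).1 = false → (secondClassPath v₀ b ω (x + 1, y)).2 = false →
      secondClassPath v₀ b ω (x + 1, y + 1) = (false, false)) ∧
    ((secondClassPath v₀ b ω (x + 1, y)).2 = (!(secondClassPath v₀ b ω (x, y + 1)).1) →
      (secondClassPath v₀ b ω (x + 1, y + 1)).2 =
        !(secondClassPath v₀ b ω (x + 1, y + 1)).1) := by
  have h := vertexOut_discrepancy (ω (x + 1, y + 1))
    (outgoing_mono (le_addArrow b v₀) ω x (y + 1)).1 (outgoing_mono (le_addArrow b v₀) ω (x + 1) y).2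
  rw [← outgoing_succ_succ, ← outgoing_succ_succ] at h
  exact ⟨fun h₁ h₂ => Prod.ext (h.1 h₁ h₂).1 (h.1 h₁ h₂).2, h.2⟩

theorem secondClassPath_boundary {v₀ v : BoundaryVertex} (h : v ≠ v₀) (b : BoundaryData)
    (ω : VertexBits) : secondClassPath v₀ b ω v.1 = (false, false) := by
  obtain ⟨⟨x, y⟩, hv, hv0⟩ := v
  rw [secondClassPath_apply]
  match x, y, hv, hv0, h with
  | 0, 0, _, hv0, _ => exact absurd rfl hv0
  | 0, y + 1, _, _, h => simp only [outgoing]; rw [addArrow_of_ne h]; simp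
  | x + 1, 0, _, _, h => simp only [outgoing]; rw [addArrow_of_ne h]; simp
  | x + 1, y + 1, hv, _, _ => simp at hv

theorem secondClassPath_start {v₀ : BoundaryVertex} {b : BoundaryData} (hb : b v₀ = false)
    (ω : VertexBits) :
    (secondClassPath v₀ b ω v₀.1).2 = !(secondClassPath v₀ b ω v₀.1).1 := by
  obtain ⟨⟨x, y⟩, hv, hv0⟩ := v₀
  rw [secondClassPath_apply]
  match x, y, hv, hv0, hb with
  | 0, 0, _, hv0, _ => exact absurd rfl hv0
  | 0, y + 1, _, _, hb => simp only [outgoing]; rw [addArrow_self, hb]; rfl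
  | x + 1, 0, _, _, hb => simp only [outgoing]; rw [addArrow_self, hb]; rfl
  | x + 1, y + 1, hv, _, _ => simp at hv

theorem secondClassPath_zero_zero (v₀ : BoundaryVertex) (b : BoundaryData) (ω : VertexBits) :
    secondClassPath v₀ b ω (0, 0) = (false, false) := by
  rw [secondClassPath_apply]; simp only [outgoing]; rfl

theorem secondClassPath_of_lt (v₀ : BoundaryVertex) (b : BoundaryData) (ω : VertexBits) (x y : ℕ)
    (h : x + y < v₀.1.1 + v₀.1.2) : secondClassPath v₀ b ω (x, y) = (false, false) := by
  induction hn : x + y generalizing x y with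
  | zero =>
    obtain ⟨rfl, rfl⟩ : x = 0 ∧ y = 0 := by omega
    exact secondClassPath_zero_zero v₀ b ω
  | succ n ih =>
    match x, y, hn, h with
    | 0, y + 1, _, h =>
      refine secondClassPath_boundary (v := ⟨(0, y + 1), by simp⟩) ?_ b ω
      rintro rfl; simp at h
    | x + 1, 0, _, h =>
      refine secondClassPath_boundary (v := ⟨(x + 1, 0), by simp⟩) ?_ b ω
      rintro rfl; simp at h
    | x + 1, y + 1, hn, h =>
      refine (secondClassPath_succ_succ v₀ b ω x y).1 ?_ ?_
      · rw [ih x (y + 1) (by omega) (by omega)]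
      · rw [ih (x + 1) y (by omega) (by omega)]

/-- On the line `x + y = n`, the edge set `Q` has exactly one outgoing edge; it leaves `u`, to the
right if `d` is true and upwards otherwise. -/
def SingleEdgeOnLine (Q : ArrowEnsemble) (n : ℕ) (u : ℕ × ℕ) (d : Bool) : Prop :=
  u.1 + u.2 = n ∧ Q u = (d, !d) ∧ ∀ v : ℕ × ℕ, v.1 + v.2 = n → v ≠ u → Q v = (false, false)

/-- The endpoint of the edge leaving `u` in the direction `d`. -/
def edgeEnd (u : ℕ × ℕ) (d : Bool) : ℕ × ℕ := if d then (u.1 + 1, u.2) else (u.1, u.2 + 1)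

theorem SingleEdgeOnLine.passesThrough_iff {Q : ArrowEnsemble} {n : ℕ} {u : ℕ × ℕ} {d : Bool}
    (h : SingleEdgeOnLine Q n u d) (v : ℕ × ℕ) :
    v.1 + v.2 = n ∧ PassesThrough Q v ↔ v = u := by
  constructor
  · rintro ⟨hv, hQ⟩
    by_contra hne
    simp [PassesThrough, h.2.2 v hv hne] at hQ
  · rintro rfl
    refine ⟨h.1, ?_⟩
    rw [PassesThrough, h.2.1]
    cases d <;> simp

theorem SingleEdgeOnLine.fst_eq {Q : ArrowEnsemble} {n : ℕ} {u : ℕ × ℕ} {d : Bool}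
    (h : SingleEdgeOnLine Q n u d) {v : ℕ × ℕ} (hv : v.1 + v.2 = n) :
    (Q v).1 = decide (v = u ∧ d = true) := by
  by_cases hvu : v = u
  · subst hvu; rw [h.2.1]; simp
  · rw [h.2.2 v hv hvu]; simp [hvu]

theorem SingleEdgeOnLine.snd_eq {Q : ArrowEnsemble} {n : ℕ} {u : ℕ × ℕ} {d : Bool}
    (h : SingleEdgeOnLine Q n u d) {v : ℕ × ℕ} (hv : v.1 + v.2 = n) :
    (Q v).2 = decide (v = u ∧ d = false) := by
  by_cases hvu : v = u
  · subst hvu; rw [h.2.1]; simp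
  · rw [h.2.2 v hv hvu]; simp [hvu]

theorem singleEdgeOnLine_start {v₀ : BoundaryVertex} {b : BoundaryData} (hb : b v₀ = false)
    (ω : VertexBits) :
    SingleEdgeOnLine (secondClassPath v₀ b ω) (v₀.1.1 + v₀.1.2) v₀.1
      (secondClassPath v₀ b ω v₀.1).1 := by
  refine ⟨rfl, Prod.ext rfl (secondClassPath_start hb ω), ?_⟩
  rintro ⟨x, y⟩ hv hne
  match x, y, hv, hne with
  | 0, 0, _, _ => exact secondClassPath_zero_zero v₀ b ω
  | 0, y + 1, _, hne =>
    exact secondClassPath_boundary (v := ⟨(0, y + 1), by simp⟩) (fun h => hne (congrArg Subtype.val h)) b ω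
  | x + 1, 0, _, hne =>
    exact secondClassPath_boundary (v := ⟨(x + 1, 0), by simp⟩) (fun h => hne (congrArg Subtype.val h)) b ω
  | x + 1, y + 1, hv, _ =>
    refine (secondClassPath_succ_succ v₀ b ω x y).1 ?_ ?_
    · rw [secondClassPath_of_lt v₀ b ω x (y + 1) (by simp at hv; omega)]
    · rw [secondClassPath_of_lt v₀ b ω (x + 1) y (by simp at hv; omega)]

/-- The second class particle enters the bulk along each of its edges. -/
theorem secondClassPath_edgeEnd_pos {v₀ : BoundaryVertex} {b : BoundaryData} {ω : VertexBits}
    {u : ℕ × ℕ} {d : Bool} (h : secondClassPath v₀ b ω u = (d, !d)) :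
    ∃ x y, edgeEnd u d = (x + 1, y + 1) := by
  obtain ⟨x, y⟩ := u
  rw [secondClassPath_apply] at h
  cases d <;> match x, y, h with
  | 0, 0, h => simp [outgoing] at h
  | 0, y + 1, h => simp [outgoing] at h; try exact ⟨_, _, rfl⟩
  | x + 1, 0, h => simp [outgoing] at h; try exact ⟨_, _, rfl⟩
  | x + 1, y + 1, h => exact ⟨_, _, rfl⟩

/-- The single edge leaving line `n` enters one vertex, where conservation gives exactly one
outgoing edge. Other bulk vertices of the next line receive no discrepancy and emit none. -/
theorem SingleEdgeOnLine.succ {v₀ : BoundaryVertex} {b : BoundaryData} {ω : VertexBits} {n : ℕ}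
    {u : ℕ × ℕ} {d : Bool} (h : SingleEdgeOnLine (secondClassPath v₀ b ω) n u d)
    (hn : v₀.1.1 + v₀.1.2 ≤ n) :
    SingleEdgeOnLine (secondClassPath v₀ b ω) (n + 1) (edgeEnd u d)
      (secondClassPath v₀ b ω (edgeEnd u d)).1 := by
  have hsum : (edgeEnd u d).1 + (edgeEnd u d).2 = n + 1 := by
    rw [← h.1]; cases d <;> simp [edgeEnd] <;> omega
  refine ⟨hsum, Prod.ext rfl ?_, ?_⟩
  · obtain ⟨x, y, hxy⟩ := secondClassPath_edgeEnd_pos h.2.1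
    rw [hxy] at hsum ⊢
    simp only at hsum
    refine (secondClassPath_succ_succ v₀ b ω x y).2 ?_
    rw [h.fst_eq (by simp; omega), h.snd_eq (by simp; omega)]
    obtain ⟨u₁, u₂⟩ := u
    cases d <;> simp [edgeEnd] at hxy ⊢ <;> omega
  · rintro ⟨x, y⟩ hv hne
    match x, y, hv, hne with
    | 0, 0, _, _ => exact secondClassPath_zero_zero v₀ b ω
    | 0, y + 1, hv, _ =>
      refine secondClassPath_boundary (v := ⟨(0, y + 1), by simp⟩) ?_ b ω
      -- `hn` puts `v₀` on a line strictly below `n + 1`, so no boundary vertex of the new line is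
      -- the starting point.
      rintro rfl; simp at hv hn; omega
    | x + 1, 0, hv, _ =>
      refine secondClassPath_boundary (v := ⟨(x + 1, 0), by simp⟩) ?_ b ω
      rintro rfl; simp at hv hn; omega
    | x + 1, y + 1, hv, hne =>
      simp only at hv
      refine (secondClassPath_succ_succ v₀ b ω x y).1 ?_ ?_
      · rw [h.fst_eq (by simp; omega)]
        refine decide_eq_false ?_
        rintro ⟨rfl, rfl⟩
        exact hne (by simp [edgeEnd])
      · rw [h.snd_eq (by simp; omega)]
        refine decide_eq_false ?_
        rintro ⟨rfl, rfl⟩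
        exact hne (by simp [edgeEnd])

/-! ### Ordering of the two second class particles -/

/-- If the bits of the two systems are compatible at every vertex, then the second class particle
of `ξ` stays weakly to the southeast of that of `η`. -/
theorem weaklySoutheastOnLine_of_compatibleBits {v₀ : BoundaryVertex} {b b' : BoundaryData}
    {ω ω' : VertexBits} (hb : b v₀ = false) (hb' : b' v₀ = false) (hle : b' ≤ b)
    (hc : ∀ x y, CompatibleBits (edgeStates v₀ b b' ω ω' x (y + 1)).1
      (edgeStates v₀ b b' ω ω' (x + 1) y).2 (ω (x + 1, y + 1)) (ω' (x + 1, y + 1)))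
    (n : ℕ) (hn : v₀.1.1 + v₀.1.2 ≤ n) :
    WeaklySoutheastOnLine (secondClassPath v₀ b ω) (secondClassPath v₀ b' ω') n := by
  -- The order of the vertices alone is not inductive: particles at the same vertex must also have
  -- ordered exit directions.
  suffices H : ∃ u d u' d', SingleEdgeOnLine (secondClassPath v₀ b ω) n u d ∧
      SingleEdgeOnLine (secondClassPath v₀ b' ω') n u' d' ∧ u'.1 ≤ u.1 ∧
      (u = u' → d' = true → d = true) by
    obtain ⟨u, d, u', d', h, h', hu, -⟩ := H
    refine ⟨u, u', h.passesThrough_iff, h'.passesThrough_iff, hu, ?_⟩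
    have := h.1
    have := h'.1
    omega
  induction n, hn using Nat.le_induction with
  | base =>
    refine ⟨_, _, _, _, singleEdgeOnLine_start hb ω, singleEdgeOnLine_start hb' ω', le_rfl, ?_⟩
    intro _
    have hs := secondClassPath_start hb ω
    have hs' := secondClassPath_start hb' ω'
    obtain ⟨⟨x, y⟩, hv, hv0⟩ := v₀
    simp only [secondClassPath_apply] at hs hs' ⊢
    match x, y, hv, hv0 with
    | 0, 0, _, hv0 => exact absurd rfl hv0
    | 0, y + 1, _, _ => simp_all [outgoing]
    | x + 1, 0, _, _ => simp_all [outgoing]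
    | x + 1, y + 1, hv, _ => simp at hv
  | succ n hn ih =>
    obtain ⟨u, d, u', d', h, h', hu, hd⟩ := ih
    refine ⟨_, _, _, _, h.succ hn, h'.succ hn, ?_, ?_⟩
    · have h₁ := h.1
      have h₂ := h'.1
      -- Distinct vertices have first coordinates at least one apart, and a step raises each by at
      -- most one; so only a common vertex needs the directions.
      by_cases huu : u.1 = u'.1
      · have : u = u' := Prod.ext huu (by omega)
        subst this
        have := hd rfl
        cases d <;> cases d' <;> simp_all [edgeEnd]
      · cases d <;> cases d' <;> simp [edgeEnd] <;> omega
    · intro heq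
      obtain ⟨x, y, hxy⟩ := secondClassPath_edgeEnd_pos h.2.1
      have hxy' := heq ▸ hxy
      have hsum := (h.succ hn).1
      rw [hxy] at hsum
      rw [← heq, hxy, secondClassPath_fst_edge v₀ b b' ω ω', secondClassPath_snd_edge v₀ b b' ω ω']
      simp only at hsum ⊢
      rw [edgeStates_succ_succ]
      have hadm := edgeStates_admissible hb hb' hle hc
      have f₁ := h.fst_eq (v := (x, y + 1)) (by simp; omega)
      have f₂ := h.snd_eq (v := (x + 1, y)) (by simp; omega)
      have f₁' := h'.fst_eq (v := (x, y + 1)) (by simp; omega)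
      have f₂' := h'.snd_eq (v := (x + 1, y)) (by simp; omega)
      rw [secondClassPath_fst_edge v₀ b b' ω ω'] at f₁ f₂
      rw [secondClassPath_snd_edge v₀ b b' ω ω'] at f₁' f₂'
      refine (hc x y).marked_right (hadm x (y + 1)).1 (hadm (x + 1) y).2 ?_ ?_ ?_
      · simp only at f₁ f₂
        rw [f₁, f₂]
        obtain ⟨u₁, u₂⟩ := u
        cases d <;> simp [edgeEnd] at hxy ⊢ <;> omega
      · simp only at f₁' f₂'
        rw [f₁', f₂']
        obtain ⟨u₁, u₂⟩ := u'
        cases d' <;> simp [edgeEnd] at hxy' ⊢ <;> omega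
      -- If the particle of ξ arrives horizontally, it comes from `(x, y + 1)`; then `hu` rules out
      -- `(x + 1, y)` as the previous vertex of the other.
      · simp only at f₁ f₁'
        rw [f₁, f₁']
        obtain ⟨u₁, u₂⟩ := u
        obtain ⟨u₁', u₂'⟩ := u'
        rw [Bool.le_iff_imp]
        cases d <;> cases d' <;> simp [edgeEnd] at hxy hxy' hu ⊢ <;> omega

/-! ### The local coupling of the bits -/

/-- The bits of the two systems at a vertex with incoming edge states `H` and `V`, as a function of
two uniform variables: both systems use the same bits, except possibly when two second
class particles (of `ξ⁺` over `η`) meet there. -/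
noncomputable def coupledBits (δ₁ δ₂ : unitInterval) (H V : EdgeState)
    (θ : unitInterval × unitInterval) : (Bool × Bool) × (Bool × Bool) :=
  if bothSecondClass H V then
    match V.1, V.2.2.2 with
    | false, true => ((decide (θ.2 < δ₁), decide (θ.1 < δ₂)), (decide (θ.1 < δ₁), decide (θ.2 < δ₂)))
    | true, false => ((decide (θ.1 < δ₁), decide (θ.2 < δ₂)), (decide (θ.2 < δ₁), decide (θ.1 < δ₂)))
    | false, false => ((decide (θ.2 < δ₁), decide (θ.1 < δ₂)),
        (decide (θ.2 < δ₁), decide (unitInterval.symm θ.1 < δ₂)))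
    | true, true => ((decide (θ.1 < δ₁), decide (θ.2 < δ₂)), (decide (θ.1 < δ₁), decide (θ.2 < δ₂)))
  else ((decide (θ.1 < δ₁), decide (θ.2 < δ₂)), (decide (θ.1 < δ₁), decide (θ.2 < δ₂)))

/-- Whenever a condition has to be enforced, both bits in it are read from `θ.1`. Two conditions say
that `θ.1 < δ₂` forces `θ.1 < δ₁`; the third holds because `θ.1 < δ₂` and `1 - θ.1 < δ₂` would give
`1 < 2 * δ₂`. -/
theorem compatibleBits_coupledBits {δ₁ δ₂ : unitInterval} (h₁₂ : δ₂ < δ₁) (h₂ : (δ₂ : ℝ) ≤ 1 / 2)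
    (H V : EdgeState) (θ : unitInterval × unitInterval) :
    CompatibleBits H V (coupledBits δ₁ δ₂ H V θ).1 (coupledBits δ₁ δ₂ H V θ).2 := by
  have hlt : ∀ t : unitInterval, decide (t < δ₂) ≤ decide (t < δ₁) := fun t => by
    rw [Bool.le_iff_imp]
    simpa using fun h : t < δ₂ => h.trans h₁₂
  have hdis : (decide (θ.1 < δ₂) && decide (unitInterval.symm θ.1 < δ₂)) = false := by
    rw [Bool.and_eq_false_iff, decide_eq_false_iff_not, decide_eq_false_iff_not, or_iff_not_imp_left,
      not_not]
    intro h h'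
    have h : (θ.1 : ℝ) < δ₂ := h
    have h' : (1 - θ.1 : ℝ) < δ₂ := h'
    linarith
  unfold CompatibleBits coupledBits
  split_ifs with h
  · rcases V with ⟨v₁, v₂, v₃, v₄⟩
    cases v₁ <;> cases v₄ <;> simp [hlt]
    simpa using hdis
  · rfl

theorem measurable_coupledBits (δ₁ δ₂ : unitInterval) (H V : EdgeState) :
    Measurable (coupledBits δ₁ δ₂ H V) := by
  have m₁ := measurable_decide_lt δ₁
  have m₂ := measurable_decide_lt δ₂
  have m₃ : Measurable fun t : unitInterval => decide (unitInterval.symm t < δ₂) :=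
    m₂.comp unitInterval.measurable_symm
  have f₁ : Measurable (Prod.fst : unitInterval × unitInterval → unitInterval) := measurable_fst
  have f₂ : Measurable (Prod.snd : unitInterval × unitInterval → unitInterval) := measurable_snd
  have a₁ := m₁.comp f₁
  have a₂ := m₂.comp f₁
  have a₃ := m₃.comp f₁
  have b₁ := m₁.comp f₂
  have b₂ := m₂.comp f₂
  unfold coupledBits
  split_ifs
  · rcases V with ⟨v₁, v₂, v₃, v₄⟩
    cases v₁ <;> cases v₄
    · exact (b₁.prodMk a₂).prodMk (b₁.prodMk a₃)
    · exact (b₁.prodMk a₂).prodMk (a₁.prodMk b₂)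
    · exact (a₁.prodMk b₂).prodMk (b₁.prodMk a₂)
    · exact (a₁.prodMk b₂).prodMk (a₁.prodMk b₂)
  · exact (a₁.prodMk b₂).prodMk (a₁.prodMk b₂)

theorem map_prodMk_volume {f g : unitInterval → Bool} (hf : Measurable f) (hg : Measurable g) :
    (volume : Measure (unitInterval × unitInterval)).map (fun θ => (f θ.1, g θ.2)) =
      (volume.map f).prod (volume.map g) :=
  (Measure.map_prod_map _ _ hf hg).symm

theorem map_prodMk_swap_volume {f g : unitInterval → Bool} (hf : Measurable f) (hg : Measurable g) :
    (volume : Measure (unitInterval × unitInterval)).map (fun θ => (f θ.2, g θ.1)) =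
      (volume.map f).prod (volume.map g) := by
  rw [← map_prodMk_volume hf hg]
  conv_rhs => rw [Measure.volume_eq_prod, ← Measure.prod_swap]
  rw [Measure.map_map (by fun_prop) measurable_swap]
  rfl

/-- In every branch each system reads its two bits from different uniform variables, possibly
reflected, which makes them independent. Only the joint law of the two systems depends on the
branch. -/
theorem map_coupledBits (δ₁ δ₂ : unitInterval) (H V : EdgeState) :
    volume.map (fun θ => (coupledBits δ₁ δ₂ H V θ).1) =
        (bernoulliMeasure true false δ₁).prod (bernoulliMeasure true false δ₂) ∧
      volume.map (fun θ => (coupledBits δ₁ δ₂ H V θ).2) =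
        (bernoulliMeasure true false δ₁).prod (bernoulliMeasure true false δ₂) := by
  have m₁ := measurable_decide_lt δ₁
  have m₂ := measurable_decide_lt δ₂
  have m₃ : Measurable fun t : unitInterval => decide (unitInterval.symm t < δ₂) :=
    m₂.comp unitInterval.measurable_symm
  have l₃ : volume.map (fun t : unitInterval => decide (unitInterval.symm t < δ₂)) =
      bernoulliMeasure true false δ₂ := by
    rw [← map_decide_lt_volume δ₂]
    conv_rhs => rw [← unitInterval.measurePreserving_symm.map_eq]
    rw [Measure.map_map m₂ unitInterval.measurable_symm]
    rfl
  have h := map_prodMk_volume m₁ m₂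
  have h' := map_prodMk_swap_volume m₁ m₂
  have h'' := map_prodMk_swap_volume m₁ m₃
  rw [l₃] at h''
  rw [map_decide_lt_volume] at h h' h''
  rw [map_decide_lt_volume] at h h'
  unfold coupledBits
  split_ifs
  · rcases V with ⟨v₁, v₂, v₃, v₄⟩
    cases v₁ <;> cases v₄
    · exact ⟨h', h''⟩
    · exact ⟨h', h⟩
    · exact ⟨h, h'⟩
    · exact ⟨h, h⟩
  · exact ⟨h, h⟩

/-! ### The coupled fields and their causal structure -/

/-- The four coupled ensembles, driven by independent pairs of uniform variables. -/
noncomputable def coupledStates (δ₁ δ₂ : unitInterval) (v₀ : BoundaryVertex) (b b' : BoundaryData)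
    (u : ℕ × ℕ → unitInterval × unitInterval) : ℕ → ℕ → EdgeState × EdgeState
  | 0, 0 => default
  | 0, y + 1 =>
      ((b ⟨(0, y + 1), by simp⟩, addArrow b v₀ ⟨(0, y + 1), by simp⟩, b' ⟨(0, y + 1), by simp⟩,
        addArrow b' v₀ ⟨(0, y + 1), by simp⟩), default)
  | x + 1, 0 =>
      (default, (b ⟨(x + 1, 0), by simp⟩, addArrow b v₀ ⟨(x + 1, 0), by simp⟩,
        b' ⟨(x + 1, 0), by simp⟩, addArrow b' v₀ ⟨(x + 1, 0), by simp⟩))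
  | x + 1, y + 1 =>
      let H := (coupledStates δ₁ δ₂ v₀ b b' u x (y + 1)).1
      let V := (coupledStates δ₁ δ₂ v₀ b b' u (x + 1) y).2
      let c := coupledBits δ₁ δ₂ H V (u (x + 1, y + 1))
      edgeStateOut c.1 c.2 H V
  termination_by x y => x + y

/-- The states of the edges entering a vertex (junk on the axes). -/
noncomputable def coupledIncoming (δ₁ δ₂ : unitInterval) (v₀ : BoundaryVertex) (b b' : BoundaryData)
    (u : ℕ × ℕ → unitInterval × unitInterval) : ℕ × ℕ → EdgeState × EdgeState
  | (x + 1, y + 1) =>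
      ((coupledStates δ₁ δ₂ v₀ b b' u x (y + 1)).1, (coupledStates δ₁ δ₂ v₀ b b' u (x + 1) y).2)
  | _ => default

/-- The bits used by the two coupled systems. -/
noncomputable def coupledField (δ₁ δ₂ : unitInterval) (v₀ : BoundaryVertex) (b b' : BoundaryData)
    (u : ℕ × ℕ → unitInterval × unitInterval) (v : ℕ × ℕ) : (Bool × Bool) × (Bool × Bool) :=
  coupledBits δ₁ δ₂ (coupledIncoming δ₁ δ₂ v₀ b b' u v).1 (coupledIncoming δ₁ δ₂ v₀ b b' u v).2 (u v)

section

variable (δ₁ δ₂ : unitInterval) (v₀ : BoundaryVertex) (b b' : BoundaryData)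

/-- Consistency of the construction: the bits are chosen from edge states produced by earlier bits,
and running the model with them reproduces those states. -/
theorem edgeStates_coupledField (u : ℕ × ℕ → unitInterval × unitInterval) (x y : ℕ) :
    edgeStates v₀ b b' (fun v => (coupledField δ₁ δ₂ v₀ b b' u v).1)
      (fun v => (coupledField δ₁ δ₂ v₀ b b' u v).2) x y = coupledStates δ₁ δ₂ v₀ b b' u x y := by
  induction hn : x + y generalizing x y with
  | zero =>
    obtain ⟨rfl, rfl⟩ : x = 0 ∧ y = 0 := by omega
    -- `default` is the edge state with all entries `false`, that is, an edge empty in all four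
    -- ensembles.
    simp only [edgeStates, outgoing, coupledStates]; rfl
  | succ n ih =>
    match x, y, hn with
    | 0, y + 1, _ => simp only [edgeStates, outgoing, coupledStates]; rfl
    | x + 1, 0, _ => simp only [edgeStates, outgoing, coupledStates]; rfl
    | x + 1, y + 1, hn =>
      rw [edgeStates_succ_succ, ih x (y + 1) (by omega), ih (x + 1) y (by omega), coupledStates]
      rfl

/-- Causality: the edges leaving a vertex depend only on the variables there and on earlier
anti-diagonals. This supplies the adaptedness for `map_infinitePi_of_adapted`. -/
theorem coupledStates_update (u : ℕ × ℕ → unitInterval × unitInterval) (w : ℕ × ℕ)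
    (θ : unitInterval × unitInterval) (x y : ℕ) (hne : w ≠ (x, y)) (hle : x + y ≤ w.1 + w.2) :
    coupledStates δ₁ δ₂ v₀ b b' (Function.update u w θ) x y =
      coupledStates δ₁ δ₂ v₀ b b' u x y := by
  induction hn : x + y generalizing x y with
  | zero =>
    obtain ⟨rfl, rfl⟩ : x = 0 ∧ y = 0 := by omega
    simp only [coupledStates]
  | succ n ih =>
    match x, y, hn with
    | 0, y + 1, _ => simp only [coupledStates]
    | x + 1, 0, _ => simp only [coupledStates]
    | x + 1, y + 1, hn =>
      rw [coupledStates, coupledStates, Function.update_of_ne hne.symm,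
        ih x (y + 1) (by rintro rfl; simp at hle) (by omega) (by omega),
        ih (x + 1) y (by rintro rfl; simp at hle) (by omega) (by omega)]

theorem coupledIncoming_update (u : ℕ × ℕ → unitInterval × unitInterval) (w : ℕ × ℕ)
    (θ : unitInterval × unitInterval) (v : ℕ × ℕ) (hle : v.1 + v.2 ≤ w.1 + w.2) :
    coupledIncoming δ₁ δ₂ v₀ b b' (Function.update u w θ) v =
      coupledIncoming δ₁ δ₂ v₀ b b' u v := by
  match v, hle with
  | (x + 1, y + 1), hle =>
    simp only at hle
    simp only [coupledIncoming]
    rw [coupledStates_update _ _ _ _ _ _ _ _ x (y + 1) (by rintro rfl; simp at hle) (by omega),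
      coupledStates_update _ _ _ _ _ _ _ _ (x + 1) y (by rintro rfl; simp at hle) (by omega)]
  | (0, _), _ => simp only [coupledIncoming]
  | (_ + 1, 0), _ => simp only [coupledIncoming]

theorem coupledField_update_self (u : ℕ × ℕ → unitInterval × unitInterval)
    (θ : unitInterval × unitInterval) (v : ℕ × ℕ) :
    coupledField δ₁ δ₂ v₀ b b' (Function.update u v θ) v =
      coupledBits δ₁ δ₂ (coupledIncoming δ₁ δ₂ v₀ b b' u v).1
        (coupledIncoming δ₁ δ₂ v₀ b b' u v).2 θ := by
  rw [coupledField, coupledIncoming_update _ _ _ _ _ _ _ _ _ le_rfl, Function.update_self]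

theorem coupledField_update_of_ne (u : ℕ × ℕ → unitInterval × unitInterval)
    (θ : unitInterval × unitInterval) (v w : ℕ × ℕ) (hne : w ≠ v) (hle : v.1 + v.2 ≤ w.1 + w.2) :
    coupledField δ₁ δ₂ v₀ b b' (Function.update u w θ) v = coupledField δ₁ δ₂ v₀ b b' u v := by
  rw [coupledField, coupledIncoming_update _ _ _ _ _ _ _ _ _ hle, Function.update_of_ne hne.symm,
    coupledField]

end

theorem compatibleBits_coupledField {δ₁ δ₂ : unitInterval} (h₁₂ : δ₂ < δ₁)
    (h₂ : (δ₂ : ℝ) ≤ 1 / 2) (v₀ : BoundaryVertex) (b b' : BoundaryData)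
    (u : ℕ × ℕ → unitInterval × unitInterval) (x y : ℕ) :
    CompatibleBits
      (edgeStates v₀ b b' (fun v => (coupledField δ₁ δ₂ v₀ b b' u v).1)
        (fun v => (coupledField δ₁ δ₂ v₀ b b' u v).2) x (y + 1)).1
      (edgeStates v₀ b b' (fun v => (coupledField δ₁ δ₂ v₀ b b' u v).1)
        (fun v => (coupledField δ₁ δ₂ v₀ b b' u v).2) (x + 1) y).2
      (coupledField δ₁ δ₂ v₀ b b' u (x + 1, y + 1)).1
      (coupledField δ₁ δ₂ v₀ b b' u (x + 1, y + 1)).2 := by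
  rw [edgeStates_coupledField, edgeStates_coupledField]
  exact compatibleBits_coupledBits h₁₂ h₂ _ _ _

/-! ### Measurability of the coupling -/

theorem measurable_coupledBits_uncurry (δ₁ δ₂ : unitInterval) :
    Measurable fun p : (EdgeState × EdgeState) × (unitInterval × unitInterval) =>
      coupledBits δ₁ δ₂ p.1.1 p.1.2 p.2 :=
  measurable_from_prod_countable_right fun e => measurable_coupledBits δ₁ δ₂ e.1 e.2

theorem measurable_addArrow (v₀ : BoundaryVertex) (v : BoundaryVertex) :
    Measurable fun b : BoundaryData => addArrow b v₀ v := by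
  by_cases hv : v = v₀
  · subst hv; simp only [addArrow_self]; exact measurable_const
  · simp only [addArrow_of_ne hv]; fun_prop

theorem measurable_coupledStates (δ₁ δ₂ : unitInterval) (v₀ : BoundaryVertex) (x y : ℕ) :
    Measurable fun z : (BoundaryData × BoundaryData) × (ℕ × ℕ → unitInterval × unitInterval) =>
      coupledStates δ₁ δ₂ v₀ z.1.1 z.1.2 z.2 x y := by
  have hadd := measurable_addArrow v₀
  have hb : ∀ v : BoundaryVertex, Measurable fun z : (BoundaryData × BoundaryData) ×
      (ℕ × ℕ → unitInterval × unitInterval) =>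
        (z.1.1 v, addArrow z.1.1 v₀ v, z.1.2 v, addArrow z.1.2 v₀ v) := fun v =>
    Measurable.prodMk (by fun_prop) <|
      ((hadd v).comp (measurable_fst.comp measurable_fst)).prodMk <|
        Measurable.prodMk (by fun_prop) ((hadd v).comp (measurable_snd.comp measurable_fst))
  induction hn : x + y generalizing x y with
  | zero =>
    obtain ⟨rfl, rfl⟩ : x = 0 ∧ y = 0 := by omega
    simp only [coupledStates]; exact measurable_const
  | succ n ih =>
    match x, y, hn with
    | 0, y + 1, _ => simp only [coupledStates]; exact (hb _).prodMk measurable_const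
    | x + 1, 0, _ => simp only [coupledStates]; exact measurable_const.prodMk (hb _)
    | x + 1, y + 1, hn =>
      have hH := (ih x (y + 1) (by omega)).fst
      have hV := (ih (x + 1) y (by omega)).snd
      have hu : Measurable fun z : (BoundaryData × BoundaryData) ×
          (ℕ × ℕ → unitInterval × unitInterval) => z.2 (x + 1, y + 1) := by fun_prop
      have hc := (measurable_coupledBits_uncurry δ₁ δ₂).comp ((hH.prodMk hV).prodMk hu)
      have ho : Measurable fun p : ((Bool × Bool) × (Bool × Bool)) × (EdgeState × EdgeState) =>
        edgeStateOut p.1.1 p.1.2 p.2.1 p.2.2 := measurable_of_countable _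
      simp only [coupledStates]
      exact ho.comp (hc.prodMk (hH.prodMk hV))

theorem measurable_coupledField (δ₁ δ₂ : unitInterval) (v₀ : BoundaryVertex) :
    Measurable fun z : (BoundaryData × BoundaryData) × (ℕ × ℕ → unitInterval × unitInterval) =>
      coupledField δ₁ δ₂ v₀ z.1.1 z.1.2 z.2 := by
  refine measurable_pi_lambda _ fun v => ?_
  have hi : Measurable fun z : (BoundaryData × BoundaryData) ×
      (ℕ × ℕ → unitInterval × unitInterval) => coupledIncoming δ₁ δ₂ v₀ z.1.1 z.1.2 z.2 v := by
    match v with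
    | (x + 1, y + 1) =>
      exact (measurable_coupledStates δ₁ δ₂ v₀ x (y + 1)).fst.prodMk
        (measurable_coupledStates δ₁ δ₂ v₀ (x + 1) y).snd
    | (0, _) => simp only [coupledIncoming]; exact measurable_const
    | (_ + 1, 0) => simp only [coupledIncoming]; exact measurable_const
  exact (measurable_coupledBits_uncurry δ₁ δ₂).comp
    (hi.prodMk ((measurable_pi_apply v).comp measurable_snd))

/-! ### Marginal laws and the coupling measure -/

/-- The law of the uniform variables. -/
noncomputable def uniformField : Measure (ℕ × ℕ → unitInterval × unitInterval) :=
  Measure.infinitePi fun _ => volume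

instance : IsProbabilityMeasure uniformField := by
  unfold uniformField; infer_instance

/-- Each of the two systems uses bits with the law `vertexBitsLaw`, given the boundary data. -/
theorem map_coupledField (δ₁ δ₂ : unitInterval) (v₀ : BoundaryVertex)
    (f : (Bool × Bool) × (Bool × Bool) → Bool × Bool)
    (hf : ∀ H V, volume.map (fun θ => f (coupledBits δ₁ δ₂ H V θ)) =
      (bernoulliMeasure true false δ₁).prod (bernoulliMeasure true false δ₂))
    (b : BoundaryData × BoundaryData) :
    uniformField.map (fun u v => f (coupledField δ₁ δ₂ v₀ b.1 b.2 u v)) =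
      vertexBitsLaw δ₁ δ₂ := by
  refine map_infinitePi_of_adapted _ _ (fun v => v.1 + v.2) _ ?_ ?_ ?_
  · have h := (measurable_coupledField δ₁ δ₂ v₀).comp (measurable_prodMk_left (x := b))
    exact measurable_pi_lambda _ fun v =>
      (measurable_of_countable f).comp ((measurable_pi_apply v).comp h)
  · intro v w u θ hne hle
    simp only [coupledField_update_of_ne _ _ _ _ _ _ _ _ _ hne hle]
  · intro v u
    simp only [coupledField_update_self]
    -- `hf` covers every pair of incoming states, so the junk value on the axes is harmless.
    exact hf _ _

theorem sixVertexEnsemble_boundary (b : BoundaryData) (ω : VertexBits) :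
    (sixVertexEnsemble b ω).boundary = b := by
  funext ⟨⟨x, y⟩, hv, hv0⟩
  match x, y, hv, hv0 with
  | 0, 0, _, hv0 => exact absurd rfl hv0
  | 0, y + 1, _, _ => simp [ArrowEnsemble.boundary, sixVertexEnsemble, outgoing]
  | x + 1, 0, _, _ => simp [ArrowEnsemble.boundary, sixVertexEnsemble, outgoing]
  | x + 1, y + 1, hv, _ => simp at hv

/-- All quantifiers range over countable sets and each condition reads the edges at a single vertex.
This allows the almost sure statement to be pulled back to the driving variables. -/
theorem measurableSet_weaklySoutheastOnLine (m : ℕ) :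
    MeasurableSet {p : (ArrowEnsemble × ArrowEnsemble) × (ArrowEnsemble × ArrowEnsemble) |
      ∀ n : ℕ, m ≤ n → WeaklySoutheastOnLine p.1.2 p.2.2 n} := by
  have hQ : ∀ {f : (ArrowEnsemble × ArrowEnsemble) × (ArrowEnsemble × ArrowEnsemble) →
      ArrowEnsemble}, Measurable f → ∀ (n : ℕ) (v u : ℕ × ℕ),
      Measurable fun p => (v.1 + v.2 = n ∧ PassesThrough (f p) v ↔ v = u) := by
    intro f hf n v u
    exact (measurable_of_countable fun c : Bool × Bool =>
      (v.1 + v.2 = n ∧ (c.1 = true ∨ c.2 = true) ↔ v = u)).comp ((measurable_pi_apply v).comp hf)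
  refine measurableSet_setOfPred.2 ?_
  unfold WeaklySoutheastOnLine
  refine Measurable.forall fun n => measurable_const.imp <| Measurable.exists fun u =>
    Measurable.exists fun u' => ?_
  exact (Measurable.forall fun v => hQ (measurable_snd.comp measurable_fst) n v u).and
    ((Measurable.forall fun v => hQ (measurable_snd.comp measurable_snd) n v u').and
      measurable_const)

theorem proposition3p4 (δ₁ δ₂ : unitInterval) (h₁ : δ₁ < 1) (h₁₂ : δ₂ < δ₁)
    (h₂ : (δ₂ : ℝ) ≤ 1 / 2) (v₀ : BoundaryVertex)
    -- the joint law of the boundary data `(ξ₀⁻, η₀)`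
    (ρ : Measure (BoundaryData × BoundaryData)) [IsProbabilityMeasure ρ]
    (hρ : ∀ᵐ b ∂ρ, b.1 v₀ = false ∧ b.2 v₀ = false ∧ b.2 ≤ b.1) :
    -- the joint law of `((ξ⁻, Q_ξ⁻), (η, Q_η))`
    ∃ π : Measure ((ArrowEnsemble × ArrowEnsemble) × (ArrowEnsemble × ArrowEnsemble)),
      IsProbabilityMeasure π ∧
      π.map Prod.fst = secondClassLaw δ₁ δ₂ v₀ (ρ.map Prod.fst) ∧
      π.map Prod.snd = secondClassLaw δ₁ δ₂ v₀ (ρ.map Prod.snd) ∧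
      π.map (fun p => (p.1.1.boundary, p.2.1.boundary)) = ρ ∧
      ∀ᵐ p ∂π, ∀ n : ℕ, v₀.1.1 + v₀.1.2 ≤ n → WeaklySoutheastOnLine p.1.2 p.2.2 n := by
  have hF := measurable_coupledField δ₁ δ₂ v₀
  have hE := measurable_ensembleWithSecondClass v₀
  have hbits : ∀ f : (Bool × Bool) × (Bool × Bool) → Bool × Bool,
      Measurable fun z : (BoundaryData × BoundaryData) × (ℕ × ℕ → unitInterval × unitInterval) =>
        fun v => f (coupledField δ₁ δ₂ v₀ z.1.1 z.1.2 z.2 v) := fun f =>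
    measurable_pi_lambda _ fun v =>
      (measurable_of_countable f).comp ((measurable_pi_apply v).comp hF)
  have hmarg : ∀ (f : (Bool × Bool) × (Bool × Bool) → Bool × Bool)
      (g : BoundaryData × BoundaryData → BoundaryData), Measurable g →
      (∀ H V, volume.map (fun θ => f (coupledBits δ₁ δ₂ H V θ)) =
        (bernoulliMeasure true false δ₁).prod (bernoulliMeasure true false δ₂)) →
      (ρ.prod uniformField).map (fun z => ensembleWithSecondClass v₀ (g z.1)
        fun v => f (coupledField δ₁ δ₂ v₀ z.1.1 z.1.2 z.2 v)) =
        secondClassLaw δ₁ δ₂ v₀ (ρ.map g) := by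
    intro f g hg hf
    -- The bits are built from the boundary data, but their law given these data is always
    -- `vertexBitsLaw`; hence they are independent of them.
    have hskew : MeasurePreserving (fun z : (BoundaryData × BoundaryData) ×
        (ℕ × ℕ → unitInterval × unitInterval) =>
          (g z.1, fun v => f (coupledField δ₁ δ₂ v₀ z.1.1 z.1.2 z.2 v)))
        (ρ.prod uniformField) ((ρ.map g).prod (vertexBitsLaw δ₁ δ₂)) :=
      MeasurePreserving.skew_product ⟨hg, rfl⟩
        (g := fun b u v => f (coupledField δ₁ δ₂ v₀ b.1 b.2 u v)) (hbits f)
        (ae_of_all _ (map_coupledField δ₁ δ₂ v₀ f hf))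
    rw [secondClassLaw, ← hskew.map_eq, Measure.map_map hE hskew.measurable]
    rfl
  have hΦ₁ := hE.comp ((measurable_fst.comp measurable_fst).prodMk (hbits Prod.fst))
  have hΦ₂ := hE.comp ((measurable_snd.comp measurable_fst).prodMk (hbits Prod.snd))
  have hΦ := hΦ₁.prodMk hΦ₂
  refine ⟨(ρ.prod uniformField).map _, Measure.isProbabilityMeasure_map hΦ.aemeasurable,
    ?_, ?_, ?_, ?_⟩
  · rw [Measure.map_map measurable_fst hΦ]
    exact hmarg Prod.fst Prod.fst measurable_fst fun H V => (map_coupledBits δ₁ δ₂ H V).1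
  · rw [Measure.map_map measurable_snd hΦ]
    exact hmarg Prod.snd Prod.snd measurable_snd fun H V => (map_coupledBits δ₁ δ₂ H V).2
  · have hbd : Measurable ArrowEnsemble.boundary := by
      refine measurable_pi_lambda _ fun v => ?_
      unfold ArrowEnsemble.boundary
      split_ifs <;> fun_prop
    have hbd₂ : Measurable fun p : (ArrowEnsemble × ArrowEnsemble) ×
        (ArrowEnsemble × ArrowEnsemble) => (p.1.1.boundary, p.2.1.boundary) :=
      (hbd.comp (measurable_fst.comp measurable_fst)).prodMk
        (hbd.comp (measurable_fst.comp measurable_snd))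
    rw [Measure.map_map hbd₂ hΦ]
    conv_rhs => rw [← Measure.fst_prod (μ := ρ) (ν := uniformField), Measure.fst]
    congr 1
    funext z
    exact Prod.ext (sixVertexEnsemble_boundary _ _) (sixVertexEnsemble_boundary _ _)
  · rw [ae_map_iff hΦ.aemeasurable (measurableSet_weaklySoutheastOnLine _)]
    have hae := Measure.quasiMeasurePreserving_fst (μ := ρ) (ν := uniformField) |>.ae hρ
    filter_upwards [hae] with z hz
    exact weaklySoutheastOnLine_of_compatibleBits hz.1 hz.2.1 hz.2.2
      (compatibleBits_coupledField h₁₂ h₂ v₀ z.1.1 z.1.2 z.2)
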